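/- Let $K_1|K$ be a countable (that is, countably generated, possibly finite) separable-algebraic field extension, and let $v$ be a valuation on $K_1$ (of arbitrary rank) whose restriction to $K$ is non-trivial. Let $K(x)$ be the rational function field in one variable over $K$, and let $\widetilde{K(x)}$ be an algebraic closure of it which contains $K_1$ as an extension of $K$, so that $\widetilde{K_1(x)}=\widetilde{K(x)}$. Then there is an extension of $v$ from $K_1$ to a valuation, again denoted by $v$, on $\widetilde{K(x)}$ such that $$K_1^h \;=\; \mathrm{ic}(K(x)|K,v).$$ Here, for a subfield $L$ of $\widetilde{K(x)}$, $L^h$ denotes the henselization of $(L,v)$ taken inside $(\widetilde{K(x)},v)$, i.e. the fixed field, in the separable-algebraic closure $L^{\mathrm{sep}}$ of $L$ in $\widetilde{K(x)}$, of the decomposition group of all $\sigma\in\mathrm{Gal}(L^{\mathrm{sep}}|L)$ that map the valuation ring of $v$ on $L^{\mathrm{sep}}$ onto itself. The implicit constant field $\mathrm{ic}(K(x)|K,v)$ is the relative algebraic closure of $K$ in $K(x)^h$. -/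

import Mathlib

universe u u₁ u₂ u₃

namespace ValuedField

/-- The henselization `L^h` of a subfield `L` of a separably closed valued field `(Ω, w)`, taken
inside `(Ω, w)`: with `L^sep` the separable-algebraic closure of `L` in `Ω`, it is the fixed field
in `L^sep` of the decomposition group `{σ ∈ Gal(L^sep | L) | w ∘ σ ∼ w on L^sep}`
(equivalently, `σ` maps the valuation ring of `w` on `L^sep` onto itself). -/
noncomputable def henselization {Ω Γ : Type*} [Field Ω] [LinearOrderedCommGroupWithZero Γ]
    (w : Valuation Ω Γ) (L : Type*) [Field L] [Algebra L Ω] : IntermediateField L Ω :=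
  IntermediateField.lift (IntermediateField.fixedField
    ((w.comap (algebraMap (separableClosure L Ω) Ω)).valuationSubring.decompositionSubgroup L))

/-- The implicit constant field `ic(F|K, w)`: the relative algebraic closure of `K` in the
henselization `F^h` of `F` taken inside `(Ω, w)`. -/
noncomputable def implicitConstantField (K F : Type*) {Ω Γ : Type*} [Field K] [Field F] [Field Ω]
    [LinearOrderedCommGroupWithZero Γ] [Algebra K F] [Algebra F Ω] [Algebra K Ω]
    [IsScalarTower K F Ω] (w : Valuation Ω Γ) : IntermediateField K Ω :=
  algebraicClosure K Ω ⊓ (henselization w F).restrictScalars K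

end ValuedField

namespace ValuedField

open Polynomial Filter

/-! The idea is to make `x` a pseudo-limit of elements `c n` of `K₁` that generate `K₁` over `K`,
each close enough to `x` for Krasner's lemma. Let `S` and `M` be the separable closures of `K₁` and
`K(x)` in `Ω`, and let `A` be a valuation ring of `S` over `v`. The `c n` are partial sums of `∑ d i
* b i`, where the `b i` generate `K₁` and the `d i` in `K` are small (`exists_krasner_sequence`).
Sending `x` to the germ of `c` embeds `M` in an ultrapower of `S`, and the ultrapower of `A` pulls
back to a valuation ring `W` of `M`.

An automorphism of `M` over `K(x)` preserving `W` fixes every `c n` by Krasner, hence every `b n`,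
hence `K₁`; this gives `K₁^h ⊆ ic`. Conversely, an automorphism of `S` over `K₁` preserving `A` acts
componentwise on the ultrapower, fixes the germ of `c`, and so restricts to an automorphism of `M`
over `K(x)` preserving `W`; this gives `ic ⊆ K₁^h`. -/

/-- Every valuation ring of a field extends along a homomorphism of fields. -/
theorem exists_valuationSubring_comap_eq {L N : Type*} [Field L] [Field N] (f : L →+* N)
    (B : ValuationSubring L) : ∃ A : ValuationSubring N, A.comap f = B := by
  obtain ⟨A, hA⟩ := (B.toLocalSubring.map f).exists_le_valuationSubring
  refine ⟨A, ?_⟩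
  ext y
  rw [ValuationSubring.mem_comap]
  constructor
  · intro hy
    by_contra hyB
    have hy' : y⁻¹ ∈ B := (B.mem_or_inv_mem y).resolve_left hyB
    have hy0 : y ≠ 0 := fun h => hyB (h ▸ B.zero_mem)
    -- `f y⁻¹` is a unit of `A`; as `A` dominates the image of `B`, it is already a unit there.
    let u : (B.toLocalSubring.map f).toSubring := ⟨f y⁻¹, y⁻¹, hy', rfl⟩
    have hu : IsUnit (Subring.inclusion hA.1 u) := by
      refine isUnit_iff_exists_inv.mpr ⟨⟨f y, hy⟩, Subtype.ext ?_⟩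
      change f y⁻¹ * f y = 1
      rw [← map_mul, inv_mul_cancel₀ hy0, map_one]
    obtain ⟨⟨_, t, ht, rfl⟩, hw⟩ := isUnit_iff_exists_inv.mp (hA.2.1 u hu)
    have hw' : f (y⁻¹ * t) = f 1 := by
      rw [map_mul, map_one]; exact congrArg Subtype.val hw
    have : t = y := by
      have := f.injective hw'
      rwa [inv_mul_eq_one₀ hy0, eq_comm] at this
    exact hyB (this ▸ ht)
  · intro hy
    exact hA.1 ⟨y, hy, rfl⟩

/-! ### Small values in the ground field. -/

section Cofinal

variable {K S Γ : Type*} [Field K] [Field S] [Algebra K S] [Algebra.IsAlgebraic K S]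
  [LinearOrderedCommGroupWithZero Γ] (v : Valuation S Γ)

/-- In an algebraic extension the values of the ground field are coinitial. -/
theorem exists_valuation_algebraMap_le {s : S} (hs : s ≠ 0) :
    ∃ d : K, d ≠ 0 ∧ v (algebraMap K S d) ≤ v s := by
  -- The elements bounded by values of `K` form a `K`-subalgebra, closed under inverses by
  -- algebraicity. It contains `s` or `s⁻¹`, hence `s⁻¹`.
  let R : Subalgebra K S :=
    { carrier := {y | ∃ e : K, e ≠ 0 ∧ v y ≤ v (algebraMap K S e)}
      mul_mem' := by
        rintro a b ⟨e, he, hae⟩ ⟨f, hf, hbf⟩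
        exact ⟨e * f, mul_ne_zero he hf, by simpa using mul_le_mul' hae hbf⟩
      add_mem' := by
        rintro a b ⟨e, he, hae⟩ ⟨f, hf, hbf⟩
        rcases le_total (v (algebraMap K S e)) (v (algebraMap K S f)) with h | h
        · exact ⟨f, hf, v.map_add_le (hae.trans h) hbf⟩
        · exact ⟨e, he, v.map_add_le hae (hbf.trans h)⟩
      algebraMap_mem' := by
        intro r
        by_cases hr : r = 0
        · exact ⟨1, one_ne_zero, by simp [hr]⟩
        · exact ⟨r, hr, le_rfl⟩ }
  have hinv : ∀ y ∈ R, y⁻¹ ∈ R := fun y hy =>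
    R.inv_mem_of_algebraic (x := ⟨y, hy⟩) (Algebra.IsAlgebraic.isAlgebraic y)
  have hmem : s⁻¹ ∈ R := by
    rcases le_total (v s⁻¹) 1 with h | h
    · exact ⟨1, one_ne_zero, by simpa using h⟩
    · refine hinv s ⟨1, one_ne_zero, ?_⟩
      rw [map_inv₀] at h
      rw [map_one, map_one]
      exact (one_le_inv₀ (by simpa [zero_lt_iff] using hs)).mp h
  obtain ⟨e, he, hle⟩ := hmem
  refine ⟨e⁻¹, inv_ne_zero he, ?_⟩
  rw [map_inv₀] at hle
  rw [map_inv₀, map_inv₀]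
  exact inv_le_of_inv_le₀ (by simpa [zero_lt_iff] using hs) hle

theorem exists_valuation_algebraMap_lt (hv : (v.comap (algebraMap K S)).IsNontrivial) {s : S}
    (hs : s ≠ 0) : ∃ d : K, d ≠ 0 ∧ v (algebraMap K S d) < v s := by
  obtain ⟨d, hd, hds⟩ := exists_valuation_algebraMap_le (K := K) v hs
  obtain ⟨t, ht, ht1⟩ : ∃ t : K, t ≠ 0 ∧ v (algebraMap K S t) < 1 := by
    obtain ⟨t, ht0, ht1⟩ := hv.exists_val_nontrivial
    have ht : t ≠ 0 := fun h => ht0 (by simp [h])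
    rcases lt_or_gt_of_ne ht1 with h | h
    · exact ⟨t, ht, h⟩
    · refine ⟨t⁻¹, inv_ne_zero ht, ?_⟩
      rw [map_inv₀, map_inv₀]
      exact inv_lt_one_of_one_lt₀ h
  refine ⟨t * d, mul_ne_zero ht hd, lt_of_lt_of_le ?_ hds⟩
  rw [map_mul, map_mul]
  exact mul_lt_of_lt_one_left (by simpa [zero_lt_iff] using hd) ht1

theorem exists_valuation_algebraMap_lt_of_finset (hv : (v.comap (algebraMap K S)).IsNontrivial)
    (T : Finset S) : ∃ d : K, d ≠ 0 ∧ ∀ s ∈ T, s ≠ 0 → v (algebraMap K S d) < v s := by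
  classical
  induction T using Finset.induction_on with
  | empty => exact ⟨1, one_ne_zero, by simp⟩
  | insert a T _ ih =>
    obtain ⟨d, hd, h⟩ := ih
    by_cases ha : a = 0
    · exact ⟨d, hd, fun s hs hs0 => by
        rcases Finset.mem_insert.mp hs with rfl | hs
        · exact absurd ha hs0
        · exact h s hs hs0⟩
    obtain ⟨e, he, hea⟩ := exists_valuation_algebraMap_lt v hv ha
    rcases le_total (v (algebraMap K S e)) (v (algebraMap K S d)) with hle | hle
    · refine ⟨e, he, fun s hs hs0 => ?_⟩
      rcases Finset.mem_insert.mp hs with rfl | hs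
      · exact hea
      · exact hle.trans_lt (h s hs hs0)
    · refine ⟨d, hd, fun s hs hs0 => ?_⟩
      rcases Finset.mem_insert.mp hs with rfl | hs
      · exact hle.trans_lt hea
      · exact h s hs hs0

end Cofinal

/-! ### Construction of the approximating sequence. -/

section KrasnerSequence

variable {K K₁ S Γ : Type*} [Field K] [Field K₁] [Field S] [Algebra K K₁] [Algebra K S]
  [Algebra K₁ S] [IsScalarTower K K₁ S] [LinearOrderedCommGroupWithZero Γ]

/-- `z` bounds the distances of `c` to its other conjugates over `K` strictly from below. -/
def IsKrasnerBound (v : Valuation S Γ) (c : K₁) (z : K) : Prop :=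
  z ≠ 0 ∧ ∀ y : S, aeval y (minpoly K c) = 0 → y ≠ algebraMap K₁ S c →
    v (algebraMap K S z) < v (algebraMap K₁ S c - y)

theorem exists_isKrasnerBound [Algebra.IsAlgebraic K S] (v : Valuation S Γ)
    (hv : (v.comap (algebraMap K S)).IsNontrivial) (c : K₁) {s : S} (hs : s ≠ 0) :
    ∃ z : K, IsKrasnerBound v c z ∧ v (algebraMap K S z) < v s := by
  classical
  obtain ⟨z, hz, h⟩ := exists_valuation_algebraMap_lt_of_finset v hv
    (insert s (((minpoly K c).aroots S).toFinset.image fun y => algebraMap K₁ S c - y))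
  refine ⟨z, ⟨hz, fun y hy hyc => ?_⟩, h s (Finset.mem_insert_self _ _) hs⟩
  refine h _ (Finset.mem_insert_of_mem (Finset.mem_image_of_mem _ ?_)) (sub_ne_zero.mpr hyc.symm)
  have hint : IsIntegral K c := (isIntegral_algebraMap_iff (algebraMap K₁ S).injective).mp
    (Algebra.IsAlgebraic.isAlgebraic (R := K) (algebraMap K₁ S c)).isIntegral
  rw [Multiset.mem_toFinset, mem_aroots]
  exact ⟨minpoly.ne_zero hint, hy⟩

/-- Two choices alternate: `d n` makes the step `c (n + 1) - c n` smaller than `z n`, then `z (n +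
1)` is taken smaller than that step. So the `z n` decrease and later steps cannot undo earlier ones.
Injectivity will make the germ of `c` transcendental over `S`. -/
theorem exists_krasner_sequence [Algebra.IsAlgebraic K S] (v : Valuation S Γ)
    (hv : (v.comap (algebraMap K S)).IsNontrivial) (b : ℕ → K₁) (hb : ∀ n, b n ≠ 0) :
    ∃ (c : ℕ → K₁) (z d : ℕ → K), (∀ n, IsKrasnerBound v (c n) (z n)) ∧
      (∀ n, d n ≠ 0 ∧ c (n + 1) = c n + algebraMap K K₁ (d n) * b n) ∧
      (∀ n m, n < m → v (algebraMap K₁ S (c m - c n)) < v (algebraMap K S (z n))) ∧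
      Function.Injective c := by
  have step : ∀ (n : ℕ) (p : {p : K₁ × K // IsKrasnerBound v p.1 p.2}),
      ∃ (q : {p : K₁ × K // IsKrasnerBound v p.1 p.2}) (d : K), d ≠ 0 ∧
        q.1.1 = p.1.1 + algebraMap K K₁ d * b n ∧
        v (algebraMap K₁ S (q.1.1 - p.1.1)) < v (algebraMap K S p.1.2) ∧
        v (algebraMap K S q.1.2) < v (algebraMap K₁ S (q.1.1 - p.1.1)) := by
    rintro n ⟨⟨c, z⟩, hcz⟩
    have hb' : algebraMap K₁ S (b n) ≠ 0 := by simpa using hb n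
    obtain ⟨d, hd, hdz⟩ := exists_valuation_algebraMap_lt v hv
      (div_ne_zero (by simpa using hcz.1 : algebraMap K S z ≠ 0) hb')
    have hlt : v (algebraMap K₁ S (algebraMap K K₁ d * b n)) < v (algebraMap K S z) := by
      rw [map_div₀, lt_div_iff₀ (by simpa [zero_lt_iff] using hb n)] at hdz
      rwa [map_mul, map_mul, ← IsScalarTower.algebraMap_apply]
    have hne : algebraMap K₁ S (algebraMap K K₁ d * b n) ≠ 0 := by
      simpa using ⟨hd, hb n⟩
    obtain ⟨z', hz', hz'lt⟩ :=
      exists_isKrasnerBound v hv (c + algebraMap K K₁ d * b n) hne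
    exact ⟨⟨(_, z'), hz'⟩, d, hd, rfl, by simpa using hlt, by simpa using hz'lt⟩
  choose next d hd hnext hlt hgt using step
  obtain ⟨z₀, hz₀, -⟩ := exists_isKrasnerBound v hv (0 : K₁) one_ne_zero
  let p : ℕ → {p : K₁ × K // IsKrasnerBound v p.1 p.2} :=
    fun n => Nat.rec ⟨(0, z₀), hz₀⟩ next n
  have hstep : ∀ n, v (algebraMap K₁ S ((p (n + 1)).1.1 - (p n).1.1)) <
      v (algebraMap K S (p n).1.2) := fun n => hlt n (p n)
  have hstep' : ∀ n, v (algebraMap K S (p (n + 1)).1.2) <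
      v (algebraMap K₁ S ((p (n + 1)).1.1 - (p n).1.1)) := fun n => hgt n (p n)
  have hanti : Antitone fun n => v (algebraMap K S (p n).1.2) :=
    antitone_nat_of_succ_le fun n => ((hstep' n).trans (hstep n)).le
  have hclose : ∀ n m, n < m → v (algebraMap K₁ S ((p m).1.1 - (p n).1.1)) <
      v (algebraMap K S (p n).1.2) := by
    intro n m hnm
    induction m, hnm using Nat.le_induction with
    | base => exact hstep n
    | succ m hm ih =>
      have : (p (m + 1)).1.1 - (p n).1.1 =
        ((p (m + 1)).1.1 - (p m).1.1) + ((p m).1.1 - (p n).1.1) := by ring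
      rw [this, map_add]
      exact v.map_add_lt ((hstep m).trans_le (hanti (Nat.le_of_succ_le hm))) ih
  refine ⟨fun n => (p n).1.1, fun n => (p n).1.2, fun n => d n (p n), fun n => (p n).2,
    fun n => ⟨hd n _, hnext n _⟩, hclose, Function.Injective.of_lt_imp_ne fun n m hnm heq => ?_⟩
  -- Past `n + 1` the sequence stays closer to `c (n + 1)` than `c n` is, so it cannot return to `c
  -- n`.
  rcases (Nat.succ_le_of_lt hnm).eq_or_lt with rfl | hlt'
  · have := hstep' n
    rw [show (p (n + 1)).1.1 - (p n).1.1 = 0 from sub_eq_zero.mpr heq.symm] at this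
    simp at this
  · have h1 := (hclose (n + 1) m hlt').trans (hstep' n)
    change (p n).1.1 = (p m).1.1 at heq
    rw [← heq, ← neg_sub, map_neg, v.map_neg] at h1
    exact lt_irrefl _ h1

end KrasnerSequence

/-! ### Ultrapowers of valued fields. -/

section Ultrapower

variable {α S : Type*} [Field S] (φ : Ultrafilter α)

/-- The ultrapower of a valuation ring, as a valuation ring of the ultrapower of the field. -/
def germValuationSubring (A : ValuationSubring S) : ValuationSubring (Germ (φ : Filter α) S) where
  carrier := {g | g.LiftPred (· ∈ A)}
  mul_mem' {a b} := Germ.inductionOn₂ a b fun _ _ ha hb => by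
    filter_upwards [ha, hb] with n h1 h2 using A.mul_mem _ _ h1 h2
  one_mem' := Eventually.of_forall fun _ => A.one_mem
  add_mem' {a b} := Germ.inductionOn₂ a b fun _ _ ha hb => by
    filter_upwards [ha, hb] with n h1 h2 using A.add_mem _ _ h1 h2
  zero_mem' := Eventually.of_forall fun _ => A.zero_mem
  neg_mem' {a} := Germ.inductionOn a fun _ ha => by
    filter_upwards [ha] with n h1 using A.neg_mem _ h1
  mem_or_inv_mem' a := Germ.inductionOn a fun f =>
    Ultrafilter.eventually_or.mp (Eventually.of_forall fun n => A.mem_or_inv_mem (f n))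

theorem coe_mem_germValuationSubring {A : ValuationSubring S} {f : α → S} :
    (f : Germ (φ : Filter α) S) ∈ germValuationSubring φ A ↔ ∀ᶠ n in φ, f n ∈ A :=
  Iff.rfl

/-- The map induced on an ultrapower by an endomorphism of the field. -/
def germMap (τ : S →+* S) : Germ (φ : Filter α) S →+* Germ (φ : Filter α) S where
  toFun := Germ.map τ
  map_one' := congrArg (Germ.ofFun) (funext fun _ => map_one τ)
  map_zero' := congrArg (Germ.ofFun) (funext fun _ => map_zero τ)
  map_mul' a b := Germ.inductionOn₂ a b fun _ _ =>
    congrArg (Germ.ofFun) (funext fun _ => map_mul τ _ _)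
  map_add' a b := Germ.inductionOn₂ a b fun _ _ =>
    congrArg (Germ.ofFun) (funext fun _ => map_add τ _ _)

theorem germMap_coe (τ : S →+* S) (f : α → S) :
    germMap φ τ (f : Germ (φ : Filter α) S) = ((fun n => τ (f n) : α → S) : Germ _ S) :=
  rfl

theorem germMap_mem_germValuationSubring {A : ValuationSubring S} {τ : S →+* S}
    (hτ : ∀ s, τ s ∈ A ↔ s ∈ A) (g : Germ (φ : Filter α) S) :
    germMap φ τ g ∈ germValuationSubring φ A ↔ g ∈ germValuationSubring φ A :=
  Germ.inductionOn g fun f => by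
    rw [germMap_coe, coe_mem_germValuationSubring, coe_mem_germValuationSubring]
    simp only [hτ]

/-- The diagonal embedding of a field in its ultrapower. -/
def germConst : S →+* Germ (φ : Filter α) S :=
  (Germ.coeRingHom (φ : Filter α)).comp (Pi.constRingHom α S)

theorem germConst_apply (s : S) : germConst φ s = ((fun _ => s : α → S) : Germ _ S) :=
  rfl

theorem eval₂_germConst (p : S[X]) (c : α → S) :
    p.eval₂ (germConst φ) (c : Germ (φ : Filter α) S) =
      ((fun n => p.eval (c n) : α → S) : Germ _ S) := by
  rw [germConst, show (c : Germ (φ : Filter α) S) = Germ.coeRingHom _ c from rfl,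
    ← hom_eval₂]
  exact congrArg Germ.ofFun (funext fun n =>
    hom_eval₂ p (Pi.constRingHom α S) (Pi.evalRingHom (fun _ : α => S) n) c)

/-- A nonzero polynomial has finitely many roots, and an injective sequence meets them at finitely
many indices, a set outside the hyperfilter. -/
theorem eval₂_germConst_eq_zero_iff {c : ℕ → S} (hc : Function.Injective c) (p : S[X]) :
    p.eval₂ (germConst (hyperfilter ℕ)) (c : Germ (hyperfilter ℕ : Filter ℕ) S) = 0 ↔ p = 0 := by
  refine ⟨fun h => ?_, fun h => by simp [h]⟩
  by_contra hp
  rw [eval₂_germConst] at h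
  have h' : ∀ᶠ n in (hyperfilter ℕ : Filter ℕ), p.eval (c n) = 0 := Germ.coe_eq.mp h
  refine Set.Finite.notMem_hyperfilter ?_ h'
  classical
  refine Set.Finite.subset ((p.roots.toFinset.finite_toSet).preimage hc.injOn) fun n hn => ?_
  simpa [hp] using hn

theorem eventually_map_evalRingHom_eq_zero {D : (α → S)[X]}
    (hD : D.map (Germ.coeRingHom (φ : Filter α)) = 0) :
    ∀ᶠ n in φ, D.map (Pi.evalRingHom (fun _ : α => S) n) = 0 := by
  have h : ∀ i ∈ D.support, ∀ᶠ n in (φ : Filter α), D.coeff i n = 0 := by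
    intro i _
    have := congrArg (fun q => q.coeff i) hD
    simp only [coeff_map, coeff_zero] at this
    exact Germ.coe_eq.mp this
  filter_upwards [(D.support.eventually_all).mpr h] with n hn
  ext i
  simp only [coeff_map, coeff_zero]
  by_cases hi : i ∈ D.support
  · exact hn i hi
  · rw [notMem_support_iff.mp hi]; rfl

/-- A Łoś-type argument: separability is a Bézout identity between `p` and its derivative, that is,
finitely many coefficient equations. It holds at almost every index, where a root can be chosen. -/
instance isSepClosed_germ [IsSepClosed S] : IsSepClosed (Germ (φ : Filter α) S) := by
  refine IsSepClosed.of_exists_root _ fun p hp hirr hsep => ?_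
  have hsurj : Function.Surjective (Germ.coeRingHom (R := S) (φ : Filter α)) :=
    fun g => Germ.inductionOn g fun f => ⟨f, rfl⟩
  have hlift : ∀ q : (Germ (φ : Filter α) S)[X], ∃ Q : (α → S)[X], Q.map (Germ.coeRingHom _) = q :=
    map_surjective _ hsurj
  obtain ⟨P, hP, hPdeg, hPm⟩ := lifts_and_degree_eq_and_monic (hlift p) hp
  obtain ⟨a, b, hab⟩ := hsep
  obtain ⟨a, rfl⟩ := hlift a
  obtain ⟨b, rfl⟩ := hlift b
  have hD : (a * P + b * derivative P - 1).map (Germ.coeRingHom (φ : Filter α)) = 0 := by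
    rw [Polynomial.map_sub, Polynomial.map_add, Polynomial.map_mul, Polynomial.map_mul,
      ← derivative_map, hP, hab, Polynomial.map_one, sub_self]
  have hex : ∀ᶠ n in φ, ∃ r : S, (P.map (Pi.evalRingHom (fun _ : α => S) n)).eval r = 0 := by
    filter_upwards [eventually_map_evalRingHom_eq_zero φ hD] with n hn
    refine IsSepClosed.exists_root _ ?_ ⟨a.map (Pi.evalRingHom _ n), b.map (Pi.evalRingHom _ n), ?_⟩
    · rw [hPm.degree_map, hPdeg]
      exact hirr.degree_pos.ne'
    · rw [derivative_map, ← Polynomial.map_mul, ← Polynomial.map_mul, ← Polynomial.map_add,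
        ← sub_eq_zero]
      simpa using hn
  obtain ⟨r, hr⟩ := hex.choice
  refine ⟨Germ.coeRingHom _ r, ?_⟩
  rw [← hP, eval_map, eval₂_hom]
  refine Germ.coe_eq.mpr ?_
  filter_upwards [hr] with n hn
  rw [eval_map] at hn
  have := hom_eval₂ P (RingHom.id _) (Pi.evalRingHom (fun _ : α => S) n) r
  rw [RingHom.comp_id] at this
  exact this.trans hn

end Ultrapower

/-! ### Embeddings of `M` and descent of separability. -/

/-- A separable extension of a simple transcendental extension `S(x)` maps to any separably closed
extension of `S`, with `x` going to any prescribed element transcendental over `S`. -/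
theorem exists_ringHom_of_transcendental {S M U : Type*} [Field S] [Field M] [Field U] [Algebra S M]
    [IsSepClosed U] {x : M} (hx : Transcendental S x)
    [Algebra.IsSeparable (IntermediateField.adjoin S {x}) M] (f : S →+* U) {u : U}
    (hu : ∀ p : S[X], p.eval₂ f u = 0 → p = 0) :
    ∃ φ : M →+* U, (∀ s, φ (algebraMap S M s) = f s) ∧ φ x = u := by
  let : Algebra S U := f.toAlgebra
  have hu' : Transcendental S u := transcendental_iff.mpr hu
  let e : IntermediateField.adjoin S {x} →ₐ[S] U :=
    (IntermediateField.adjoin S {u}).val.comp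
      ((RatFunc.algEquivOfTranscendental x hx).symm.trans
        (RatFunc.algEquivOfTranscendental u hu')).toAlgHom
  let : Algebra (IntermediateField.adjoin S {x}) U := e.toRingHom.toAlgebra
  let φ : M →ₐ[IntermediateField.adjoin S {x}] U := IsSepClosed.lift
  refine ⟨φ, fun s => ?_, ?_⟩
  · refine (φ.commutes (algebraMap S _ s)).trans ?_
    exact e.commutes s
  · refine (φ.commutes (IntermediateField.AdjoinSimple.gen S x)).trans ?_
    change ((RatFunc.algEquivOfTranscendental u hu')
      ((RatFunc.algEquivOfTranscendental x hx).symm (IntermediateField.AdjoinSimple.gen S x)) : U) = u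
    simp

/-- `K` is relatively algebraically closed in `K(x)`. -/
theorem exists_C_eq_of_isIntegral {K : Type*} [Field K] {f : RatFunc K} (hf : IsIntegral K f) :
    ∃ c, f = RatFunc.C c := by
  by_contra h
  exact RatFunc.transcendental_of_ne_C f h hf.isAlgebraic

/-- The minimal polynomial over `K(x)` divides the one over `K`, so its coefficients are algebraic
over `K` and therefore lie in `K`. -/
theorem isSeparable_of_isSeparable_ratFunc {K Ω : Type*} [Field K] [Field Ω] [Algebra K Ω]
    [Algebra (RatFunc K) Ω] [IsScalarTower K (RatFunc K) Ω] {a : Ω} (ha : IsAlgebraic K a)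
    (hs : IsSeparable (RatFunc K) a) : IsSeparable K a := by
  have hint : IsIntegral K a := ha.isIntegral
  have hcoeff : ∀ i, IsIntegral K ((minpoly (RatFunc K) a).coeff i) :=
    isIntegral_coeff_of_dvd _ _ (minpoly.monic hint) (minpoly.monic hint.tower_top)
      (minpoly.dvd_map_of_isScalarTower K (RatFunc K) a)
  have hlift : minpoly (RatFunc K) a ∈ lifts (algebraMap K (RatFunc K)) := by
    rw [lifts_iff_coeff_lifts]
    intro i
    obtain ⟨c, hc⟩ := exists_C_eq_of_isIntegral (hcoeff i)
    exact ⟨c, hc.symm⟩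
  obtain ⟨g, hg⟩ := (mem_lifts _).mp hlift
  have hga : aeval a g = 0 := by
    rw [← aeval_map_algebraMap (RatFunc K), hg, minpoly.aeval]
  have hgsep : g.Separable := by
    rw [← separable_map (algebraMap K (RatFunc K)), hg]
    exact hs
  exact hgsep.of_dvd (minpoly.dvd K a hga)

/-! ### The valuation ring on the separable closure of `K(x)`. -/

section Main

variable {K K₁ S M : Type*} [Field K] [Field K₁] [Field S] [Field M] [Algebra K K₁] [Algebra K S]
  [Algebra K₁ S] [IsScalarTower K K₁ S] [Algebra S M] [Algebra K M] [IsScalarTower K S M]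

/-- Krasner's lemma: `σ` fixes `x` and `z` and preserves `W`, so `c` and its conjugate `σ c` both
lie within `z` of `x`, hence within `z` of each other. -/
theorem algHom_apply_eq_of_isKrasnerBound [IsSepClosed S] [Algebra.IsSeparable K K₁]
    {A : ValuationSubring S} {W : ValuationSubring M} (hW : W.comap (algebraMap S M) = A)
    {c : K₁} {z : K} (hz : IsKrasnerBound A.valuation c z) (σ : M →ₐ[K] M)
    (hσ : ∀ m, m ∈ W → σ m ∈ W) {x : M} (hx : σ x = x)
    (hxc : (x - algebraMap S M (algebraMap K₁ S c)) / algebraMap K M z ∈ W) :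
    σ (algebraMap S M (algebraMap K₁ S c)) = algebraMap S M (algebraMap K₁ S c) := by
  have hsepc : IsSeparable K c := Algebra.IsSeparable.isSeparable K c
  have hroot : aeval (algebraMap S M (algebraMap K₁ S c)) (minpoly K c) = 0 := by
    rw [aeval_algebraMap_apply, aeval_algebraMap_apply, minpoly.aeval, map_zero, map_zero]
  have hroot' : aeval (σ (algebraMap S M (algebraMap K₁ S c))) (minpoly K c) = 0 := by
    rw [aeval_algHom_apply, hroot, map_zero]
  -- The Krasner bound speaks only of conjugates in `S`; all of them lie there, since `c` is
  -- separable.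
  obtain ⟨y, hy⟩ : σ (algebraMap S M (algebraMap K₁ S c)) ∈ (algebraMap S M).range := by
    refine (IsSepClosed.splits_codomain (f := algebraMap K S) (minpoly K c) hsepc).mem_range_of_isRoot
      (Polynomial.map_ne_zero (minpoly.ne_zero hsepc.isIntegral)) ?_
    rw [Polynomial.map_map, ← IsScalarTower.algebraMap_eq, IsRoot, eval_map_algebraMap]
    exact hroot'
  rw [← hy] at hroot' ⊢
  congr 1
  by_contra hne
  have hyroot : aeval y (minpoly K c) = 0 := by
    rw [aeval_algebraMap_apply] at hroot'
    simpa using hroot'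
  have hlt := hz.2 y hyroot hne
  have h1 := hσ _ hxc
  rw [map_div₀, map_sub, hx, ← hy, AlgHom.commutes] at h1
  have h2 := W.toSubring.sub_mem h1 hxc
  rw [ValuationSubring.mem_toSubring, ← sub_div, sub_sub_sub_cancel_left, IsScalarTower.algebraMap_apply K S M, ← map_sub,
    ← map_div₀, ← ValuationSubring.mem_comap, hW, ← ValuationSubring.valuation_le_one_iff,
    map_div₀, div_le_one₀ (by simpa [zero_lt_iff] using hz.1)] at h2
  exact not_le_of_gt hlt h2

variable [Algebra (RatFunc K) M] [IsScalarTower K (RatFunc K) M]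

theorem isSeparable_adjoin_X [Algebra.IsSeparable (RatFunc K) M] :
    Algebra.IsSeparable (IntermediateField.adjoin S {algebraMap (RatFunc K) M RatFunc.X}) M := by
  set E := IntermediateField.adjoin S {algebraMap (RatFunc K) M RatFunc.X} with hE
  have hmem : ∀ f : RatFunc K, algebraMap (RatFunc K) M f ∈ E := by
    intro f
    obtain ⟨p, q, -, rfl⟩ := IsFractionRing.div_surjective K[X] f
    have hp : ∀ p : K[X], algebraMap (RatFunc K) M (algebraMap K[X] (RatFunc K) p) ∈ E := by
      intro p
      induction p using Polynomial.induction_on' with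
      | add p q hp hq => simpa using E.add_mem hp hq
      | monomial n a =>
        rw [← C_mul_X_pow_eq_monomial, map_mul, map_mul, map_pow, map_pow, RatFunc.algebraMap_X]
        refine E.mul_mem ?_ (pow_mem (IntermediateField.mem_adjoin_simple_self _ _) n)
        rw [RatFunc.algebraMap_C, ← RatFunc.algebraMap_eq_C, ← IsScalarTower.algebraMap_apply,
          IsScalarTower.algebraMap_apply K S M]
        exact E.algebraMap_mem _
    rw [map_div₀]
    exact E.div_mem (hp p) (hp q)
  let : Algebra (RatFunc K) E := ((algebraMap (RatFunc K) M).codRestrict E hmem).toAlgebra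
  have : IsScalarTower (RatFunc K) E M := IsScalarTower.of_algebraMap_eq fun _ => rfl
  exact Algebra.isSeparable_tower_top_of_isSeparable (RatFunc K) E M

theorem exists_valuationSubring_ratFunc_closure [IsSepClosed S] [Algebra.IsSeparable K K₁]
    [Algebra.IsAlgebraic K S] [Algebra.IsSeparable (RatFunc K) M] [Normal (RatFunc K) M]
    (A : ValuationSubring S) (hA : (A.valuation.comap (algebraMap K S)).IsNontrivial)
    (b : ℕ → K₁) (hb : ∀ n, b n ≠ 0) (hgen : IntermediateField.adjoin K (Set.range b) = ⊤) :
    ∃ W : ValuationSubring M, W.comap (algebraMap S M) = A ∧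
      (∀ σ : M ≃ₐ[RatFunc K] M, (∀ m, σ m ∈ W ↔ m ∈ W) → ∀ k : K₁,
        σ (algebraMap S M (algebraMap K₁ S k)) = algebraMap S M (algebraMap K₁ S k)) ∧
      (∀ τ : S ≃ₐ[K₁] S, (∀ s, τ s ∈ A ↔ s ∈ A) →
        ∃ σ : M ≃ₐ[RatFunc K] M, (∀ m, σ m ∈ W ↔ m ∈ W) ∧
          ∀ s, σ (algebraMap S M s) = algebraMap S M (τ s)) := by
  obtain ⟨c, z, d, hcz, hcd, hclose, hinj⟩ := exists_krasner_sequence A.valuation hA b hb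
  let u := hyperfilter ℕ
  let cS : ℕ → S := fun n => algebraMap K₁ S (c n)
  set x : M := algebraMap (RatFunc K) M RatFunc.X with hx
  have hxK : Transcendental K x :=
    (transcendental_algebraMap_iff (algebraMap (RatFunc K) M).injective).mpr RatFunc.transcendental_X
  have hxS : Transcendental S x := hxK.extendScalars S
  have := isSeparable_adjoin_X (K := K) (S := S) (M := M)
  obtain ⟨φ, hφS, hφx⟩ := exists_ringHom_of_transcendental hxS (germConst u) (u := (cS : Germ _ S))
    fun p hp => (eval₂_germConst_eq_zero_iff
      (fun _ _ h => hinj ((algebraMap K₁ S).injective h)) p).mp hp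
  let W : ValuationSubring M := (germValuationSubring u A).comap φ
  have hWA : W.comap (algebraMap S M) = A := by
    ext s
    rw [ValuationSubring.mem_comap, ValuationSubring.mem_comap, hφS]
    exact Germ.liftPred_const_iff
  refine ⟨W, hWA, fun σ hσ => ?_, fun τ hτ => ?_⟩
  · let j : K₁ →ₐ[K] M := (IsScalarTower.toAlgHom K S M).comp (IsScalarTower.toAlgHom K K₁ S)
    let σK : M →ₐ[K] M := σ.toAlgHom.restrictScalars K
    have hσx : σK x = x := σ.commutes _
    have hfix : ∀ n, σK (j (c n)) = j (c n) := by
      intro n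
      refine algHom_apply_eq_of_isKrasnerBound hWA (hcz n) σK (fun m => (hσ m).mpr) hσx ?_
      rw [ValuationSubring.mem_comap, map_div₀, map_sub, hφx, hφS,
        IsScalarTower.algebraMap_apply K S M, hφS]
      change ((fun m => (cS m - cS n) / algebraMap K S (z n) : ℕ → S) : Germ (u : Filter ℕ) S) ∈ _
      rw [coe_mem_germValuationSubring]
      filter_upwards [Nat.hyperfilter_le_atTop (eventually_gt_atTop n)] with m hm
      rw [← ValuationSubring.valuation_le_one_iff, map_div₀, ← map_sub]
      exact div_le_one_of_le₀ (hclose n m hm).le zero_le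
    -- `b n` is recovered from `c (n + 1) - c n = d n * b n` with `d n` in `K`.
    have hfixb : ∀ n, σK (j (b n)) = j (b n) := by
      intro n
      obtain ⟨hd, hcn⟩ := hcd n
      have h := hfix (n + 1)
      rw [hcn, map_add, map_add, hfix n, map_mul, map_mul, AlgHom.commutes, AlgHom.commutes] at h
      exact mul_left_cancel₀ (by simpa using hd) (add_left_cancel h)
    intro k
    have hext : (σK.comp j).comp (⊤ : IntermediateField K K₁).val =
        j.comp (⊤ : IntermediateField K K₁).val := by
      refine IntermediateField.algHom_ext_of_eq_adjoin K hgen.symm ?_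
      rintro _ ⟨n, rfl⟩
      exact hfixb n
    exact DFunLike.congr_fun hext (⟨k, trivial⟩ : (⊤ : IntermediateField K K₁))
  -- The componentwise action of `τ` fixes the image of `K(x)`, as `τ` fixes `K` and every `c n`.
  -- Normality of `M` then lets it restrict to `M`.
  · have hcomm : ((germMap u (τ : S →+* S)).comp φ).comp (algebraMap (RatFunc K) M) =
        φ.comp (algebraMap (RatFunc K) M) := by
      refine IsFractionRing.ringHom_ext (A := K[X]) fun p => ?_
      refine RingHom.congr_fun (f := (((germMap u (τ : S →+* S)).comp φ).comp
        (algebraMap (RatFunc K) M)).comp (algebraMap K[X] (RatFunc K)))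
        (g := (φ.comp (algebraMap (RatFunc K) M)).comp (algebraMap K[X] (RatFunc K))) ?_ p
      refine Polynomial.ringHom_ext (fun a => ?_) ?_
      · simp only [RingHom.comp_apply]
        rw [RatFunc.algebraMap_C, ← RatFunc.algebraMap_eq_C, ← IsScalarTower.algebraMap_apply,
          IsScalarTower.algebraMap_apply K S M, hφS, germConst_apply, germMap_coe]
        refine congrArg Germ.ofFun (funext fun _ => ?_)
        rw [IsScalarTower.algebraMap_apply K K₁ S]
        exact τ.commutes _
      · simp only [RingHom.comp_apply]
        rw [RatFunc.algebraMap_X, ← hx, hφx, germMap_coe]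
        exact congrArg Germ.ofFun (funext fun n => τ.commutes _)
    let : Algebra M (Germ (u : Filter ℕ) S) := φ.toAlgebra
    let : Algebra (RatFunc K) (Germ (u : Filter ℕ) S) :=
      (φ.comp (algebraMap (RatFunc K) M)).toAlgebra
    have : IsScalarTower (RatFunc K) M (Germ (u : Filter ℕ) S) :=
      IsScalarTower.of_algebraMap_eq fun _ => rfl
    let T : Germ (u : Filter ℕ) S →ₐ[RatFunc K] Germ (u : Filter ℕ) S :=
      { germMap u (τ : S →+* S) with commutes' := fun r => RingHom.congr_fun hcomm r }
    have hT : ∀ m : M, φ (T.restrictNormal' M m) = germMap u (τ : S →+* S) (φ m) :=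
      T.restrictNormal_commutes M
    refine ⟨T.restrictNormal' M, fun m => ?_, fun s => φ.injective ?_⟩
    · rw [ValuationSubring.mem_comap, ValuationSubring.mem_comap, hT]
      exact germMap_mem_germValuationSubring u hτ _
    · rw [hT, hφS, hφS]
      rfl

end Main

/-! ### Decomposition groups and comparison of the two fields. -/

open scoped Pointwise in
theorem mem_decompositionSubgroup_iff {L N : Type*} [Field L] [Field N] [Algebra L N]
    (A : ValuationSubring N) (g : N ≃ₐ[L] N) :
    g ∈ A.decompositionSubgroup L ↔ ∀ y, g y ∈ A ↔ y ∈ A := by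
  rw [ValuationSubring.decompositionSubgroup, MulAction.mem_stabilizer_iff]
  constructor
  · intro h y
    conv_lhs => rw [← h]
    exact ValuationSubring.smul_mem_pointwise_smul_iff (g := g) (S := A) (x := y)
  · intro h
    ext y
    rw [ValuationSubring.mem_pointwise_smul_iff_inv_smul_mem, ← h (g⁻¹ • y)]
    exact iff_of_eq (congrArg (· ∈ A) (g.apply_symm_apply y))

theorem mem_henselization_iff {Ω : Type*} [Field Ω] (V : ValuationSubring Ω) (L : Type*) [Field L]
    [Algebra L Ω] {a : Ω} :
    a ∈ henselization V.valuation L ↔ ∃ h : a ∈ separableClosure L Ω,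
      ∀ g : separableClosure L Ω ≃ₐ[L] separableClosure L Ω,
        (∀ y, g y ∈ V.comap (algebraMap _ Ω) ↔ y ∈ V.comap (algebraMap (separableClosure L Ω) Ω)) →
          g ⟨a, h⟩ = ⟨a, h⟩ := by
  have hV : (V.valuation.comap (algebraMap (separableClosure L Ω) Ω)).valuationSubring =
      V.comap (algebraMap (separableClosure L Ω) Ω) := by
    ext y
    exact V.valuation_le_one_iff _
  rw [henselization, hV]
  constructor
  · rintro ⟨⟨y, hy⟩, hfix, rfl⟩
    exact ⟨hy, fun g hg => hfix ⟨g, (mem_decompositionSubgroup_iff _ g).mpr hg⟩⟩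
  · rintro ⟨h, hfix⟩
    exact ⟨⟨a, h⟩, fun g => hfix g ((mem_decompositionSubgroup_iff _ _).mp g.2), rfl⟩

theorem exists_restrict_of_fixes {K₁ S M : Type*} [Field K₁] [Field S] [Field M] [Algebra K₁ S]
    [Algebra S M] [Normal K₁ S] (σ : M →+* M)
    (hσ : ∀ k : K₁, σ (algebraMap S M (algebraMap K₁ S k)) = algebraMap S M (algebraMap K₁ S k)) :
    ∃ τ : S ≃ₐ[K₁] S, ∀ s, algebraMap S M (τ s) = σ (algebraMap S M s) := by
  let : Algebra K₁ M := ((algebraMap S M).comp (algebraMap K₁ S)).toAlgebra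
  have : IsScalarTower K₁ S M := IsScalarTower.of_algebraMap_eq fun _ => rfl
  let T : M →ₐ[K₁] M := { σ with commutes' := hσ }
  exact ⟨T.restrictNormal' S, T.restrictNormal_commutes S⟩

theorem exists_seq_adjoin_eq_top {K K₁ : Type*} [Field K] [Field K₁] [Algebra K K₁]
    (hcount : ∃ S : Set K₁, S.Countable ∧ IntermediateField.adjoin K S = ⊤) :
    ∃ b : ℕ → K₁, (∀ n, b n ≠ 0) ∧ IntermediateField.adjoin K (Set.range b) = ⊤ := by
  obtain ⟨S, hS, hgen⟩ := hcount
  -- Adjoining `1` makes the set nonempty, so that it is the range of a sequence even if `S` is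
  -- empty or `{0}`.
  obtain ⟨b, hb⟩ := ((hS.mono (Set.sdiff_subset (t := {0}))).insert 1).exists_eq_range
    (Set.insert_nonempty _ _)
  refine ⟨b, fun n hn => ?_, ?_⟩
  · have : b n ∈ insert 1 (S \ {0}) := hb ▸ Set.mem_range_self n
    simp [hn] at this
  · rw [← hb, ← top_le_iff, ← hgen, IntermediateField.adjoin_le_iff]
    intro s hs
    by_cases h0 : s = 0
    · rw [h0]; exact zero_mem _
    · exact IntermediateField.subset_adjoin _ _ (Set.mem_insert_of_mem _ ⟨hs, h0⟩)

theorem isNontrivial_comap_of_comap_eq {K K₁ S Γ : Type*} [Field K] [Field K₁] [Field S]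
    [Algebra K K₁] [Algebra K S] [Algebra K₁ S] [IsScalarTower K K₁ S]
    [LinearOrderedCommGroupWithZero Γ] {v : Valuation K₁ Γ}
    (hv : (v.comap (algebraMap K K₁)).IsNontrivial) {A : ValuationSubring S}
    (hA : A.comap (algebraMap K₁ S) = v.valuationSubring) :
    (A.valuation.comap (algebraMap K S)).IsNontrivial := by
  obtain ⟨t, ht0, ht1⟩ := hv.exists_val_nontrivial
  have ht : t ≠ 0 := fun h => ht0 (by simp [h])
  have hle : ∀ t : K, A.valuation (algebraMap K S t) ≤ 1 → v (algebraMap K K₁ t) ≤ 1 := by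
    intro t h
    rw [ValuationSubring.valuation_le_one_iff, IsScalarTower.algebraMap_apply K K₁ S,
      ← ValuationSubring.mem_comap, hA] at h
    exact h
  refine ⟨⟨t, by simpa using ht, fun h => ht1 ?_⟩⟩
  change A.valuation (algebraMap K S t) = 1 at h
  refine le_antisymm (hle t h.le) ?_
  have h2 := hle t⁻¹ (by rw [map_inv₀, map_inv₀, h, inv_one])
  rw [map_inv₀, map_inv₀] at h2
  exact (inv_le_one₀ (by simpa [zero_lt_iff] using ht)).mp h2

end ValuedField

open ValuedField in
theorem theorem1p3 {K : Type u} {K₁ : Type u₁} {Γ : Type u₂} {Ω : Type u₃}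
    [Field K] [Field K₁] [Algebra K K₁] [Algebra.IsSeparable K K₁]
    -- `K₁ | K` is countably generated
    (hcount : ∃ S : Set K₁, S.Countable ∧ IntermediateField.adjoin K S = ⊤)
    -- `v` is a valuation on `K₁` which is non-trivial on `K`
    [LinearOrderedCommGroupWithZero Γ] (v : Valuation K₁ Γ)
    (hv : (v.comap (algebraMap K K₁)).IsNontrivial)
    -- `Ω` is an algebraic closure of the rational function field `K(x)`, containing `K₁` over `K`
    [Field Ω] [Algebra (RatFunc K) Ω] [IsAlgClosure (RatFunc K) Ω]
    [Algebra K Ω] [IsScalarTower K (RatFunc K) Ω] [Algebra K₁ Ω] [IsScalarTower K K₁ Ω] :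
    ∃ (Δ : Type u₃) (_ : LinearOrderedCommGroupWithZero Δ) (w : Valuation Ω Δ),
      v.HasExtension w ∧
      (ValuedField.henselization w K₁).restrictScalars K =
        ValuedField.implicitConstantField K (RatFunc K) w := by
  have : IsAlgClosed Ω := IsAlgClosure.isAlgClosed (RatFunc K)
  let S := separableClosure K₁ Ω
  let M := separableClosure (RatFunc K) Ω
  have hSK : ∀ a ∈ S, IsSeparable K a := fun a ha =>
    IsSeparable.of_algebra_isSeparable_of_isSeparable K (mem_separableClosure_iff.mp ha)
  have hSM : ∀ a ∈ S, a ∈ M := fun a ha =>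
    mem_separableClosure_iff.mpr (IsSeparable.tower_top (RatFunc K) (hSK a ha))
  let : Algebra S M := ((algebraMap S Ω).codRestrict M fun s => hSM s s.2).toAlgebra
  have : IsScalarTower S M Ω := IsScalarTower.of_algebraMap_eq fun _ => rfl
  have : IsScalarTower K S M := IsScalarTower.of_algebraMap_eq fun k => Subtype.ext rfl
  have : IsSepClosed S := IsSepClosure.sep_closed K₁
  have : Algebra.IsAlgebraic K S := Algebra.IsAlgebraic.trans K K₁ S
  have : Normal (RatFunc K) M := inferInstance
  obtain ⟨A, hA⟩ := exists_valuationSubring_comap_eq (algebraMap K₁ S) v.valuationSubring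
  obtain ⟨b, hb, hgen⟩ := exists_seq_adjoin_eq_top hcount
  obtain ⟨W, hWA, hfix, hext⟩ := exists_valuationSubring_ratFunc_closure (M := M) A
    (isNontrivial_comap_of_comap_eq hv hA) b hb hgen
  -- Any extension of `W` to `Ω` will do: both henselizations depend only on its traces `A` on `S`
  -- and `W` on `M`.
  obtain ⟨V, hV⟩ := exists_valuationSubring_comap_eq (algebraMap M Ω) W
  have hVA : V.comap (algebraMap S Ω) = A := by
    rw [← hWA, ← hV]
    rfl
  refine ⟨V.ValueGroup, inferInstance, V.valuation, ⟨?_⟩, ?_⟩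
  · rw [Valuation.isEquiv_iff_valuationSubring, ← hA, ← hVA]
    ext k
    exact (V.valuation_le_one_iff _).symm
  ext a
  rw [implicitConstantField, IntermediateField.mem_inf, IntermediateField.mem_restrictScalars,
    IntermediateField.mem_restrictScalars, mem_henselization_iff, mem_henselization_iff]
  constructor
  · rintro ⟨ha, hfixa⟩
    refine ⟨mem_algebraicClosure_iff.mpr (hSK a ha).isIntegral.isAlgebraic, hSM a ha,
      fun σ hσ => ?_⟩
    rw [hV] at hσ
    obtain ⟨τ, hτ⟩ := exists_restrict_of_fixes (σ : M →+* M) (hfix σ hσ)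
    have h := hfixa τ fun s => by
      rw [hVA, ← hWA, ValuationSubring.mem_comap, ValuationSubring.mem_comap, hτ]
      exact hσ _
    have h' := hτ ⟨a, ha⟩
    rw [h] at h'
    exact h'.symm
  · rintro ⟨halg, haM, hfixa⟩
    -- `a` is algebraic over `K` and separable over `K(x)`, hence separable over `K`.
    have haS : a ∈ S := mem_separableClosure_iff.mpr (IsSeparable.tower_top K₁
      (isSeparable_of_isSeparable_ratFunc (mem_algebraicClosure_iff.mp halg)
        (mem_separableClosure_iff.mp haM)))
    refine ⟨haS, fun τ hτ => ?_⟩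
    rw [hVA] at hτ
    obtain ⟨σ, hσ, hστ⟩ := hext τ hτ
    rw [hV] at hfixa
    exact (algebraMap S M).injective ((hστ ⟨a, haS⟩).symm.trans (hfixa σ hσ))
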